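/- All logarithms are to base $2$. For a graph $H$ and a real number $x$ let $\mathrm{RT}(n,H,x)$ be the maximum number of edges of an $H$-free (simple) graph on $n$ vertices with independence number less than $x$ (and $0$ if there is no such graph). For $f:\mathbb N\to\mathbb R$ put $$\overline{\varrho}(H,f)=\limsup_{n\to\infty}\frac{\mathrm{RT}(n,H,f(n))}{n^2},\qquad \underline{\varrho}(H,f)=\liminf_{n\to\infty}\frac{\mathrm{RT}(n,H,f(n))}{n^2}.$$ For functions $g\le f$, say that $H$ has a *phase transition from $f$ to $g$* if $\overline{\varrho}(H,g)<\underline{\varrho}(H,f)$. For $\varphi(n)\to 0$, say that $H$ has a *$\varphi$-phase-transition at $f$* if $H$ has a phase transition from $f$ to $\varphi f$. Say that $H$ has a *weak phase transition at $f$* if there is an $\varepsilon>0$ such that $\varphi_\varepsilon(n)=2^{-(\log n)^{1-\varepsilon}}$ tends to $0$ (that is, $0<\varepsilon<1$) and $H$ has a $\varphi_\varepsilon$-phase-transition at $f$. For integers $t\ge 2$ and $n$ let $Q(t,n)$ be the minimum independence number of a $K_t$-free graph on $n$ vertices. **Theorem.** Let $s$ and $t\ge 2$ be natural numbers. If $K_s$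 has a phase transition from $Q(t,n)$ to $Q(t+1,n)$, then $K_s$ has a weak phase transition at $Q(t,n)$; that is, there is an $\varepsilon>0$ for which $K_s$ has a $\varphi_\varepsilon$-phase-transition at $Q(t,n)$. -/

import Mathlib

open Filter Topology

noncomputable section

namespace RamseyTuran

/-- The Ramsey-Turán number: the maximum number of edges of an `H`-free graph on `n` vertices
whose independence number is less than `x`. It is `0` if there is no such graph. -/
def rtNumber {W : Type} (n : ℕ) (H : SimpleGraph W) (x : ℝ) : ℕ :=
  sSup {m : ℕ | ∃ G : SimpleGraph (Fin n),
    H.Free G ∧ (G.indepNum : ℝ) < x ∧ G.edgeSet.ncard = m}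

/-- The upper Ramsey-Turán density of `H` with respect to `f`. -/
def upperDensity {W : Type} (H : SimpleGraph W) (f : ℕ → ℝ) : ℝ :=
  limsup (fun n : ℕ => (rtNumber n H (f n) : ℝ) / (n : ℝ) ^ 2) atTop

/-- The lower Ramsey-Turán density of `H` with respect to `f`. -/
def lowerDensity {W : Type} (H : SimpleGraph W) (f : ℕ → ℝ) : ℝ :=
  liminf (fun n : ℕ => (rtNumber n H (f n) : ℝ) / (n : ℝ) ^ 2) atTop

/-- The inverse Ramsey function `Q(t, n)`: the minimum independence number of a
`K_t`-free graph on `n` vertices. -/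
def ramseyInv (t n : ℕ) : ℕ :=
  sInf {a : ℕ | ∃ G : SimpleGraph (Fin n), G.CliqueFree t ∧ G.indepNum = a}

/-- `H` has a phase transition from `f` to `g`, where `g ≤ f`. -/
def HasPhaseTransition {W : Type} (H : SimpleGraph W) (f g : ℕ → ℝ) : Prop :=
  (∀ n, g n ≤ f n) ∧ upperDensity H g < lowerDensity H f

/-- `H` has a `φ`-phase-transition at `f`, where `φ` tends to `0`. -/
def HasPhaseTransitionAt {W : Type} (H : SimpleGraph W) (φ f : ℕ → ℝ) : Prop :=
  Tendsto φ atTop (𝓝 0) ∧ HasPhaseTransition H f (fun n => φ n * f n)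

/-- The function `φ_ε(n) = 2 ^ (-(log₂ n) ^ (1 - ε))`. -/
def weakScale (ε : ℝ) (n : ℕ) : ℝ :=
  (2 : ℝ) ^ (-(Real.logb 2 (n : ℝ)) ^ (1 - ε))

/-- `H` has a weak phase transition at `f`. Since `φ_ε` has to tend to `0`, only `ε < 1` counts. -/
def HasWeakPhaseTransition {W : Type} (H : SimpleGraph W) (f : ℕ → ℝ) : Prop :=
  ∃ ε : ℝ, 0 < ε ∧ HasPhaseTransitionAt H (weakScale ε) f

end RamseyTuran

end

/-!
Both sides are compared with half the Turán density of `K_{r+1}`, that is `(1 - 1 / r) / 2`, where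
`r = ⌊(s - 1) / t⌋`. When `r = 0` there are no `K_s`-free graphs with independence number below
`Q(t, n)`, so let `r ≥ 1`.

Joining `r` copies of an optimal `K_{t+1}`-free graph on `m` vertices completely gives a `K_s`-free
graph on `r * m` vertices with independence number `Q(t+1, m)` and at least `(r choose 2) * m ^ 2`
edges. It is admissible for `Q(t+1, ·)` whenever `Q(t+1, m) < Q(t+1, r * m)`, and this happens for
infinitely many `m` because `Q(t+1, ·)` is unbounded. So the upper density at `Q(t+1, ·)` is at
least `(1 - 1 / r) / 2`.

Conversely, a graph with more than `((1 - 1 / r) / 2 + δ) * n ^ 2` edges contains a positive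
proportion of all possible copies of `K_{r+1}` by the Moon–Moser inequality. Dependent random choice
replaces the vertices of these cliques, one coordinate at a time, by members of any family of
`t`-sets that meets the power set of every not too small vertex set. If the independence number is
below `φ_ε(n) * Q(t, n)`, the copies of `K_t` form such a family, because
`Q(t, n) * m ≤ 2 * n * Q(t, m)`. The resulting `r + 1` completely joined copies of `K_t` contain
`K_s`. Every coordinate costs a factor `4` in `ε`.
-/

namespace RamseyTuran

open Finset SimpleGraph

section Graphs

variable {V W ι : Type*}

theorem cliqueNum_lt_iff_cliqueFree [Finite V] {G : SimpleGraph V} {n : ℕ} :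
    G.cliqueNum < n ↔ G.CliqueFree n := by
  refine ⟨fun h S hS => ?_, fun h => ?_⟩
  · have hle : #S ≤ G.cliqueNum := hS.isClique.card_le_cliqueNum
    exact (hS.card_eq ▸ hle).not_gt h
  · obtain ⟨S, hS⟩ := G.exists_isNClique_cliqueNum
    by_contra! hn
    exact h.mono hn S hS

theorem indepNum_le_of_embedding [Finite W] {G : SimpleGraph V} {H : SimpleGraph W}
    (f : G ↪g H) : G.indepNum ≤ H.indepNum := by
  have := Finite.of_injective f f.injective
  obtain ⟨S, hS⟩ := Gᶜ.exists_isNClique_cliqueNum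
  have hmap : Hᶜ.IsNClique Gᶜ.cliqueNum (S.map f.toEmbedding) :=
    hS.map.mono ((map_le_iff_le_comap _ _ _).2 (Embedding.complEquiv f).comap_eq.ge)
  have hle : #(S.map f.toEmbedding) ≤ Hᶜ.cliqueNum := hmap.isClique.card_le_cliqueNum
  simpa only [hmap.card_eq, cliqueNum_compl] using hle

theorem exists_isIndepSet_dominating (G : SimpleGraph V) (A : Finset V) :
    ∃ I ⊆ A, G.IsIndepSet (I : Set V) ∧ ∀ x ∈ A, ∃ i ∈ I, x = i ∨ G.Adj i x := by
  classical
  obtain ⟨I, hI, hmax⟩ := exists_max_image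
    (A.powerset.filter fun I : Finset V => G.IsIndepSet (I : Set V)) card
    ⟨∅, by simp [IsIndepSet]⟩
  simp only [mem_filter, mem_powerset] at hI hmax
  refine ⟨I, hI.1, hI.2, fun x hx => ?_⟩
  by_contra! hcon
  have hxI : x ∉ I := fun h => (hcon x h).1 rfl
  have hinsert : G.IsIndepSet (insert x I : Finset V) := by
    rw [coe_insert, isIndepSet_iff]
    exact hI.2.insert fun y hy _ => ⟨fun h => (hcon y hy).2 h.symm, (hcon y hy).2⟩
  have hcard := hmax (insert x I) ⟨insert_subset hx hI.1, hinsert⟩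
  rw [card_insert_of_notMem hxI] at hcard
  omega

theorem card_lt_of_cliqueFreeOn [Finite V] {G : SimpleGraph V} {t : ℕ} {A : Finset V}
    (hA : G.CliqueFreeOn A t) : #A < (G.indepNum + 1) ^ t := by
  classical
  induction t generalizing A with
  | zero => exact absurd (by simp [isNClique_iff]) (hA (t := ∅) (by simp))
  | succ t ih =>
    obtain ⟨I, hIA, hI, hdom⟩ := exists_isIndepSet_dominating G A
    have hcover : A ⊆ I.biUnion fun i => insert i {x ∈ A | G.Adj i x} := fun x hx => by
      obtain ⟨i, hi, h⟩ := hdom x hx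
      exact mem_biUnion.2 ⟨i, hi, by simpa [hx] using h⟩
    have hnbhd : ∀ i ∈ I, #(insert i {x ∈ A | G.Adj i x}) ≤ (G.indepNum + 1) ^ t := fun i hi => by
      refine (card_insert_le _ _).trans (ih ?_)
      convert hA.of_succ _ (hIA hi) using 1
      ext x
      simp
    calc #A ≤ #I * (G.indepNum + 1) ^ t :=
          (card_le_card hcover).trans (card_biUnion_le_card_mul _ _ _ hnbhd)
      _ ≤ G.indepNum * (G.indepNum + 1) ^ t := by gcongr; exact hI.card_le_indepNum
      _ < (G.indepNum + 1) ^ (t + 1) := by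
          rw [pow_succ']
          gcongr
          omega

open Classical in
theorem two_mul_ncard_edgeSet [Fintype V] (G : SimpleGraph V) :
    2 * G.edgeSet.ncard = #{p : V × V | G.Adj p.1 p.2} := by
  rw [← coe_edgeFinset, Set.ncard_coe_finset, two_mul_card_edgeFinset]

theorem ncard_edgeSet_le_card_sq [Fintype V] (G : SimpleGraph V) :
    G.edgeSet.ncard ≤ Fintype.card V ^ 2 := by
  classical
  have h := card_le_univ ({p : V × V | G.Adj p.1 p.2} : Finset (V × V))
  rw [← two_mul_ncard_edgeSet, Fintype.card_prod, ← sq] at h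
  omega

/-- The lexicographic product of `B` and `H`: every vertex of `B` is replaced by a copy of `H`, and
copies over adjacent vertices of `B` are joined completely. -/
def lexProd (B : SimpleGraph ι) (H : SimpleGraph W) : SimpleGraph (ι × W) where
  Adj p q := B.Adj p.1 q.1 ∨ p.1 = q.1 ∧ H.Adj p.2 q.2
  symm := ⟨fun _ _ h => h.imp .symm fun h => ⟨h.1.symm, h.2.symm⟩⟩
  loopless := ⟨fun _ h => h.elim (fun h => h.ne rfl) fun h => h.2.ne rfl⟩

theorem compl_lexProd (B : SimpleGraph ι) (H : SimpleGraph W) :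
    (lexProd B H)ᶜ = lexProd Bᶜ Hᶜ := by
  ext ⟨i, x⟩ ⟨j, y⟩
  simp only [lexProd, compl_adj, ne_eq, Prod.mk.injEq, not_or, not_and]
  by_cases hij : i = j
  · subst hij
    simp
  · simp [hij]

theorem cliqueNum_lexProd_le [Finite ι] [Finite W] (B : SimpleGraph ι) (H : SimpleGraph W) :
    (lexProd B H).cliqueNum ≤ B.cliqueNum * H.cliqueNum := by
  classical
  obtain ⟨K, hK⟩ := (lexProd B H).exists_isNClique_cliqueNum
  have hbase : B.IsClique (K.image Prod.fst : Finset ι) := by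
    intro i hi j hj hij
    obtain ⟨p, hp, rfl⟩ := mem_image.1 hi
    obtain ⟨q, hq, rfl⟩ := mem_image.1 hj
    exact (hK.isClique hp hq fun h => hij (by rw [h])).resolve_right fun h => hij h.1
  have hfiber : ∀ i ∈ K.image Prod.fst, #{p ∈ K | p.1 = i} ≤ H.cliqueNum := by
    intro i _
    set F : Finset (ι × W) := {p ∈ K | p.1 = i}
    have hmem : ∀ p ∈ F, p ∈ K ∧ p.1 = i := fun p hp => mem_filter.1 hp
    have hinj : Set.InjOn (Prod.snd : ι × W → W) F := fun p hp q hq h =>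
      Prod.ext ((hmem p hp).2.trans (hmem q hq).2.symm) h
    have hclique : H.IsClique (F.image Prod.snd : Finset W) := by
      intro x hx y hy hxy
      obtain ⟨p, hp, rfl⟩ := mem_image.1 hx
      obtain ⟨q, hq, rfl⟩ := mem_image.1 hy
      have hpq := hK.isClique (hmem p hp).1 (hmem q hq).1 fun h => hxy (by rw [h])
      exact (hpq.resolve_left fun h => h.ne ((hmem p hp).2.trans (hmem q hq).2.symm)).2
    rw [← card_image_of_injOn hinj]
    exact hclique.card_le_cliqueNum
  have hcard : #(K.image Prod.fst) ≤ B.cliqueNum := hbase.card_le_cliqueNum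
  calc (lexProd B H).cliqueNum = #K := hK.card_eq.symm
    _ ≤ H.cliqueNum * #(K.image Prod.fst) := card_le_mul_card_image K _ hfiber
    _ ≤ B.cliqueNum * H.cliqueNum := by rw [mul_comm]; gcongr

theorem indepNum_lexProd_le [Finite ι] [Finite W] (B : SimpleGraph ι) (H : SimpleGraph W) :
    (lexProd B H).indepNum ≤ B.indepNum * H.indepNum := by
  simpa only [← compl_lexProd, cliqueNum_compl] using cliqueNum_lexProd_le Bᶜ Hᶜ

theorem ncard_edgeSet_mul_sq_le [Finite ι] [Fintype W] (B : SimpleGraph ι) (H : SimpleGraph W) :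
    B.edgeSet.ncard * Fintype.card W ^ 2 ≤ (lexProd B H).edgeSet.ncard := by
  classical
  have := Fintype.ofFinite ι
  have hinj : #((univ.filter fun p : ι × ι => B.Adj p.1 p.2) ×ˢ (univ : Finset (W × W))) ≤
      #{p : (ι × W) × (ι × W) | (lexProd B H).Adj p.1 p.2} :=
    card_le_card_of_injOn (Equiv.prodProdProdComm ι ι W W)
      (fun p hp => by
        rw [mem_coe, mem_product, mem_filter] at hp
        exact mem_coe.2 (mem_filter.2 ⟨mem_univ _, .inl hp.1.2⟩))
      (Equiv.injective _).injOn
  rw [card_product, card_univ, Fintype.card_prod, ← two_mul_ncard_edgeSet,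
    ← two_mul_ncard_edgeSet] at hinj
  linarith

theorem cliqueNum_bot_le_one [Finite V] : (⊥ : SimpleGraph V).cliqueNum ≤ 1 :=
  Nat.lt_succ_iff.1 (cliqueNum_lt_iff_cliqueFree.2 (cliqueFree_bot le_rfl))

theorem cliqueNum_le_card [Fintype V] (G : SimpleGraph V) : G.cliqueNum ≤ Fintype.card V :=
  Nat.lt_succ_iff.1 (cliqueNum_lt_iff_cliqueFree.2 (cliqueFree_of_card_lt (Nat.lt_succ_self _)))

theorem indepNum_top_le_one [Finite V] : (⊤ : SimpleGraph V).indepNum ≤ 1 := by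
  simpa only [← compl_top, cliqueNum_compl] using cliqueNum_bot_le_one (V := V)

theorem indepNum_le_card [Fintype V] (G : SimpleGraph V) : G.indepNum ≤ Fintype.card V := by
  simpa only [cliqueNum_compl] using cliqueNum_le_card Gᶜ

end Graphs

section RamseyInv

variable {V : Type*} [Fintype V] {t : ℕ}

theorem ramseyInv_card_le_indepNum {G : SimpleGraph V} (hG : G.CliqueFree t) :
    ramseyInv t (Fintype.card V) ≤ G.indepNum := by
  let f := (G.overFinIso rfl).symm.toEmbedding
  have hmem : (G.overFin rfl).indepNum ∈ {a : ℕ | ∃ G' : SimpleGraph (Fin (Fintype.card V)),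
      G'.CliqueFree t ∧ G'.indepNum = a} := ⟨_, hG.comap f.isContained, rfl⟩
  exact (Nat.sInf_le hmem).trans (indepNum_le_of_embedding f)

theorem exists_indepNum_eq_ramseyInv (ht : 2 ≤ t) (n : ℕ) :
    ∃ G : SimpleGraph (Fin n), G.CliqueFree t ∧ G.indepNum = ramseyInv t n :=
  Nat.sInf_mem (s := {a : ℕ | ∃ G : SimpleGraph (Fin n), G.CliqueFree t ∧ G.indepNum = a})
    ⟨_, ⊥, cliqueFree_bot ht, rfl⟩

theorem lt_ramseyInv_add_one_pow (ht : 2 ≤ t) (n : ℕ) : n < (ramseyInv t n + 1) ^ t := by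
  obtain ⟨G, hG, hα⟩ := exists_indepNum_eq_ramseyInv ht n
  simpa [hα] using card_lt_of_cliqueFreeOn (A := univ) hG.cliqueFreeOn

theorem tendsto_ramseyInv (ht : 2 ≤ t) : Tendsto (ramseyInv t) atTop atTop := by
  refine tendsto_atTop.2 fun a => ?_
  filter_upwards [eventually_ge_atTop (a ^ t)] with n hn
  have h := hn.trans_lt (lt_ramseyInv_add_one_pow ht n)
  exact Nat.lt_succ_iff.1 (lt_of_pow_lt_pow_left₀ t (Nat.zero_le _) h)

theorem ramseyInv_mono (ht : 2 ≤ t) : Monotone (ramseyInv t) := fun n m hnm => by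
  obtain ⟨G, hG, hα⟩ := exists_indepNum_eq_ramseyInv ht m
  let f : G.comap (Fin.castLEEmb hnm) ↪g G := Embedding.comap (Fin.castLEEmb hnm) G
  calc ramseyInv t n ≤ (G.comap (Fin.castLEEmb hnm)).indepNum := by
        simpa using ramseyInv_card_le_indepNum (hG.comap f.isContained)
    _ ≤ G.indepNum := indepNum_le_of_embedding f
    _ = ramseyInv t m := hα

theorem ramseyInv_mul_le (ht : 2 ≤ t) (r m : ℕ) : ramseyInv t (r * m) ≤ r * ramseyInv t m := by
  obtain ⟨G, hG, hα⟩ := exists_indepNum_eq_ramseyInv ht m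
  have hfree : (lexProd (⊥ : SimpleGraph (Fin r)) G).CliqueFree t :=
    cliqueNum_lt_iff_cliqueFree.1 <| calc
      _ ≤ (⊥ : SimpleGraph (Fin r)).cliqueNum * G.cliqueNum := cliqueNum_lexProd_le _ _
      _ ≤ 1 * G.cliqueNum := by gcongr; exact cliqueNum_bot_le_one
      _ < t := by rw [one_mul]; exact cliqueNum_lt_iff_cliqueFree.2 hG
  calc ramseyInv t (r * m) ≤ (lexProd (⊥ : SimpleGraph (Fin r)) G).indepNum := by
        simpa using ramseyInv_card_le_indepNum hfree
    _ ≤ (⊥ : SimpleGraph (Fin r)).indepNum * G.indepNum := indepNum_lexProd_le _ _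
    _ ≤ r * ramseyInv t m := by
        rw [hα]
        gcongr
        simpa using indepNum_le_card (⊥ : SimpleGraph (Fin r))

theorem ramseyInv_mul_le_two_mul_mul {m n : ℕ} (ht : 2 ≤ t) (hmn : m ≤ n) :
    ramseyInv t n * m ≤ 2 * n * ramseyInv t m := by
  obtain rfl | hm := m.eq_zero_or_pos
  · simp
  calc ramseyInv t n * m ≤ ramseyInv t ((n / m + 1) * m) * m := by
        gcongr
        exact ramseyInv_mono ht (by rw [add_one_mul]; exact (Nat.lt_div_mul_add hm).le)
    _ ≤ (n / m + 1) * ramseyInv t m * m := by gcongr; exact ramseyInv_mul_le ht _ _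
    _ = (n / m * m + m) * ramseyInv t m := by ring
    _ ≤ (n + n) * ramseyInv t m := by gcongr; exact Nat.div_mul_le_self _ _
    _ = 2 * n * ramseyInv t m := by ring

theorem exists_isNClique_subset (ht : 2 ≤ t) {G : SimpleGraph V} {U : Finset V}
    (h : 2 * Fintype.card V * G.indepNum < ramseyInv t (Fintype.card V) * #U) :
    ∃ S ⊆ U, G.IsNClique t S := by
  by_contra! hcon
  have hfree : (G.induce (U : Set V)).CliqueFree t :=
    (cliqueFree_induce_iff _ _ _).2 fun S hSU => hcon S (by exact_mod_cast hSU)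
  have hα : ramseyInv t #U ≤ G.indepNum := calc
    ramseyInv t #U ≤ (G.induce (U : Set V)).indepNum := by
      simpa using ramseyInv_card_le_indepNum hfree
    _ ≤ G.indepNum := indepNum_le_of_embedding (Embedding.induce _)
  refine h.not_ge ((ramseyInv_mul_le_two_mul_mul ht U.card_le_univ).trans ?_)
  gcongr

end RamseyInv

section Density

variable {W : Type} {H : SimpleGraph W} {n : ℕ} {x c : ℝ} {f : ℕ → ℝ}

theorem bddAbove_rtNumber_set (n : ℕ) (H : SimpleGraph W) (x : ℝ) :
    BddAbove {m : ℕ | ∃ G : SimpleGraph (Fin n),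
      H.Free G ∧ (G.indepNum : ℝ) < x ∧ G.edgeSet.ncard = m} := by
  refine ⟨n ^ 2, ?_⟩
  rintro _ ⟨G, -, -, rfl⟩
  simpa using ncard_edgeSet_le_card_sq G

theorem ncard_edgeSet_le_rtNumber {V : Type*} [Fintype V] {G : SimpleGraph V} (hG : H.Free G)
    (hx : (G.indepNum : ℝ) < x) : G.edgeSet.ncard ≤ rtNumber (Fintype.card V) H x := by
  let f := G.overFinIso rfl
  refine le_csSup (bddAbove_rtNumber_set _ H x) ⟨G.overFin rfl, fun h => ?_, ?_, ?_⟩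
  · exact hG (h.trans f.symm.toEmbedding.isContained)
  · exact (Nat.cast_le.2 (indepNum_le_of_embedding f.symm.toEmbedding)).trans_lt hx
  · exact (Nat.card_congr f.mapEdgeSet).symm

theorem rtNumber_le (hc : 0 ≤ c)
    (h : ∀ G : SimpleGraph (Fin n), H.Free G → (G.indepNum : ℝ) < x → (G.edgeSet.ncard : ℝ) ≤ c) :
    (rtNumber n H x : ℝ) ≤ c := by
  rw [← Nat.le_floor_iff hc]
  refine csSup_le' ?_
  rintro _ ⟨G, hG, hx, rfl⟩
  exact Nat.le_floor (h G hG hx)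

theorem rtNumber_div_sq_le_one (n : ℕ) (H : SimpleGraph W) (x : ℝ) :
    (rtNumber n H x : ℝ) / (n : ℝ) ^ 2 ≤ 1 := by
  refine div_le_one_of_le₀ (rtNumber_le (by positivity) fun G _ _ => ?_) (by positivity)
  exact_mod_cast Fintype.card_fin n ▸ ncard_edgeSet_le_card_sq G

theorem le_upperDensity_of_frequently
    (h : ∃ᶠ n : ℕ in atTop, c ≤ (rtNumber n H (f n) : ℝ) / (n : ℝ) ^ 2) :
    c ≤ upperDensity H f :=
  le_limsup_of_frequently_le h
    (isBoundedUnder_of ⟨1, fun n => rtNumber_div_sq_le_one n H (f n)⟩)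

theorem upperDensity_le_of_eventually
    (h : ∀ᶠ n : ℕ in atTop, (rtNumber n H (f n) : ℝ) / (n : ℝ) ^ 2 ≤ c) :
    upperDensity H f ≤ c :=
  limsup_le_of_le (isCoboundedUnder_le_of_le atTop (x := 0) fun _ => by positivity) h

theorem upperDensity_nonneg : 0 ≤ upperDensity H f :=
  le_upperDensity_of_frequently (.of_forall fun _ => by positivity)

theorem free_completeGraph_iff_cliqueFree {V : Type*} {G : SimpleGraph V} {s : ℕ} :
    (completeGraph (Fin s)).Free G ↔ G.CliqueFree s := by
  rw [← cliqueFree_iff_top_free, Fintype.card_fin]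

theorem rtNumber_completeGraph_eq_zero {s t : ℕ} (hst : s ≤ t) (hx : x ≤ ramseyInv t n) :
    rtNumber n (completeGraph (Fin s)) x = 0 := by
  rw [← Nat.le_zero, ← Nat.cast_le (α := ℝ)]
  refine rtNumber_le (by simp) fun G hG hα => absurd (hα.trans_le hx) (not_lt.2 ?_)
  have hle := ramseyInv_card_le_indepNum ((free_completeGraph_iff_cliqueFree.1 hG).mono hst)
  rw [Fintype.card_fin] at hle
  exact_mod_cast hle

end Density

section LowerBound

theorem frequently_lt_apply_mul_of_tendsto_atTop {α : Type*} [LinearOrder α] [NoMaxOrder α]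
    {f : ℕ → α} (hf : Tendsto f atTop atTop) {r : ℕ} (hr : 2 ≤ r) :
    ∃ᶠ m in atTop, f m < f (r * m) := by
  intro h
  obtain ⟨N, hN⟩ := eventually_atTop.1 h
  have hpow : ∀ k, f (r ^ k * (N + 1)) ≤ f (N + 1) := fun k => by
    induction k with
    | zero => simp
    | succ k ih =>
      rw [pow_succ', mul_assoc]
      have hN' : N ≤ r ^ k * (N + 1) :=
        N.le_succ.trans (Nat.le_mul_of_pos_left _ (Nat.pow_pos (by omega)))
      exact (not_lt.1 (hN _ hN')).trans ih
  have hunbounded : Tendsto (fun k => r ^ k * (N + 1)) atTop atTop :=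
    (tendsto_pow_atTop_atTop_of_one_lt hr).atTop_mul_const' N.succ_pos
  obtain ⟨k, hk⟩ := ((hf.comp hunbounded).eventually_gt_atTop (f (N + 1))).exists
  exact (hpow k).not_gt hk

variable {s t r : ℕ}

theorem free_lexProd_top_of_cliqueFree {V : Type*} [Finite V] {G : SimpleGraph V}
    (hs : r * t < s) (hG : G.CliqueFree (t + 1)) :
    (completeGraph (Fin s)).Free (lexProd (⊤ : SimpleGraph (Fin r)) G) :=
  free_completeGraph_iff_cliqueFree.2 <| cliqueNum_lt_iff_cliqueFree.1 <| calc
    _ ≤ (⊤ : SimpleGraph (Fin r)).cliqueNum * G.cliqueNum := cliqueNum_lexProd_le _ _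
    _ ≤ r * t := by
      gcongr
      · simpa using cliqueNum_le_card (⊤ : SimpleGraph (Fin r))
      · exact Nat.lt_succ_iff.1 (cliqueNum_lt_iff_cliqueFree.2 hG)
    _ < s := hs

theorem choose_two_mul_sq_le_rtNumber {m : ℕ} (ht : 1 ≤ t) (hs : r * t < s)
    (hlt : ramseyInv (t + 1) m < ramseyInv (t + 1) (r * m)) :
    r.choose 2 * m ^ 2 ≤
      rtNumber (r * m) (completeGraph (Fin s)) (ramseyInv (t + 1) (r * m)) := by
  obtain ⟨G, hG, hα⟩ := exists_indepNum_eq_ramseyInv (Nat.succ_le_succ ht) m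
  have hind : (lexProd (⊤ : SimpleGraph (Fin r)) G).indepNum < ramseyInv (t + 1) (r * m) := calc
    _ ≤ (⊤ : SimpleGraph (Fin r)).indepNum * G.indepNum := indepNum_lexProd_le _ _
    _ ≤ 1 * G.indepNum := by gcongr; exact indepNum_top_le_one
    _ < ramseyInv (t + 1) (r * m) := by rwa [one_mul, hα]
  have hedges : (⊤ : SimpleGraph (Fin r)).edgeSet.ncard = r.choose 2 := by
    rw [← coe_edgeFinset, Set.ncard_coe_finset, card_edgeFinset_top_eq_card_choose_two,
      Fintype.card_fin]
  have hle := (ncard_edgeSet_mul_sq_le (⊤ : SimpleGraph (Fin r)) G).trans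
    (ncard_edgeSet_le_rtNumber (free_lexProd_top_of_cliqueFree hs hG) (Nat.cast_lt.2 hind))
  rw [hedges] at hle
  simpa only [Fintype.card_prod, Fintype.card_fin] using hle

theorem le_upperDensity_ramseyInv_succ (ht : 1 ≤ t) (hr : 1 ≤ r) (hs : r * t < s) :
    (1 - 1 / (r : ℝ)) / 2 ≤
      upperDensity (completeGraph (Fin s)) fun n => (ramseyInv (t + 1) n : ℝ) := by
  obtain rfl | hr := hr.eq_or_lt
  · simpa using upperDensity_nonneg
  have hmul : Tendsto (fun m => r * m) atTop atTop := tendsto_id.const_mul_atTop' (by omega)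
  refine le_upperDensity_of_frequently <| hmul.frequently <|
    ((frequently_lt_apply_mul_of_tendsto_atTop (tendsto_ramseyInv (Nat.succ_le_succ ht))
      hr).and_eventually (eventually_gt_atTop 0)).mono fun m ⟨hlt, hm⟩ => ?_
  have : (0 : ℝ) < r := by exact_mod_cast (by omega : 0 < r)
  have : (0 : ℝ) < m := by exact_mod_cast hm
  rw [le_div_iff₀ (by push_cast; positivity)]
  calc (1 - 1 / (r : ℝ)) / 2 * ((r * m : ℕ) : ℝ) ^ 2 = ((r.choose 2 * m ^ 2 : ℕ) : ℝ) := by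
        rw [Nat.cast_mul (r.choose 2), Nat.cast_choose_two]
        push_cast
        field_simp
    _ ≤ _ := by exact_mod_cast choose_two_mul_sq_le_rtNumber ht hs hlt

end LowerBound

section CommonNeighbors

variable {V W : Type*} [Fintype W]

open Classical in
/-- The common neighbourhood in `W` of a set `S` of vertices of the bipartite graph `R` between `V`
and `W`. With `R = G.Adj` it is the common neighbourhood in a graph `G`. -/
noncomputable def commonNbhd (R : V → W → Prop) (S : Set V) : Finset W :=
  {w | ∀ v ∈ S, R v w}

theorem mem_commonNbhd {R : V → W → Prop} {S : Set V} {w : W} :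
    w ∈ commonNbhd R S ↔ ∀ v ∈ S, R v w := by
  simp [commonNbhd]

end CommonNeighbors

section Supersaturation

variable {V : Type*} [Fintype V]

open Classical in
/-- The `m`-cliques of `G`, encoded as tuples of pairwise adjacent vertices, so that every clique is
counted `m!` times. Their number measures the supersaturation of dense graphs. -/
noncomputable def orderedCliques (G : SimpleGraph V) (m : ℕ) : Finset (Fin m → V) :=
  {x | Pairwise fun i j => G.Adj (x i) (x j)}

variable {G : SimpleGraph V} {m : ℕ}

theorem mem_orderedCliques {x : Fin m → V} :
    x ∈ orderedCliques G m ↔ Pairwise fun i j => G.Adj (x i) (x j) := by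
  simp [orderedCliques]

theorem insertNth_mem_orderedCliques (p : Fin (m + 1)) (v : V) (y : Fin m → V) :
    p.insertNth (α := fun _ => V) v y ∈ orderedCliques G (m + 1) ↔
      y ∈ orderedCliques G m ∧ v ∈ commonNbhd G.Adj (Set.range y) := by
  simp only [mem_orderedCliques, mem_commonNbhd, Set.forall_mem_range, Pairwise,
    Fin.forall_iff_succAbove p, Fin.insertNth_apply_same, Fin.insertNth_apply_succAbove, ne_eq,
    not_true_eq_false, false_implies, true_and, Fin.ne_succAbove p, Fin.succAbove_ne p,
    not_false_eq_true, true_implies, (Fin.succAbove_right_injective (p := p)).eq_iff, forall_and,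
    G.adj_comm v]
  tauto

theorem sum_orderedCliques_removeNth (p : Fin (m + 1)) (F : (Fin m → V) → ℕ) :
    ∑ x ∈ orderedCliques G (m + 1), F (p.removeNth x) =
      ∑ y ∈ orderedCliques G m, #(commonNbhd G.Adj (Set.range y)) * F y := by
  classical
  calc ∑ x ∈ orderedCliques G (m + 1), F (p.removeNth x)
      = ∑ z ∈ orderedCliques G m ×ˢ univ with z.2 ∈ commonNbhd G.Adj (Set.range z.1), F z.1 := by
        refine sum_bij' (fun x _ => (p.removeNth x, x p))
          (fun z _ => p.insertNth (α := fun _ => V) z.2 z.1) ?_ ?_ ?_ ?_ ?_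
        · intro x hx
          rw [← Fin.insertNth_self_removeNth p x, insertNth_mem_orderedCliques] at hx
          simpa using hx
        · intro z hz
          simpa [insertNth_mem_orderedCliques] using hz
        all_goals simp
    _ = ∑ y ∈ orderedCliques G m, #(commonNbhd G.Adj (Set.range y)) * F y := by
        simp only [sum_filter, sum_product, sum_ite_mem, univ_inter, sum_const, smul_eq_mul]

theorem card_orderedCliques_succ (G : SimpleGraph V) (m : ℕ) :
    #(orderedCliques G (m + 1)) =
      ∑ y ∈ orderedCliques G m, #(commonNbhd G.Adj (Set.range y)) := by
  simpa using sum_orderedCliques_removeNth (G := G) (m := m) 0 fun _ => 1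

theorem sum_card_commonNbhd_removeNth_le (x : Fin (m + 1) → V) :
    ∑ p : Fin (m + 1), #(commonNbhd G.Adj (Set.range (p.removeNth x))) ≤
      Fintype.card V + m * #(commonNbhd G.Adj (Set.range x)) := by
  classical
  have hcount : ∀ v, #{p : Fin (m + 1) | v ∈ commonNbhd G.Adj (Set.range (p.removeNth x))} ≤
      1 + m * if v ∈ commonNbhd G.Adj (Set.range x) then 1 else 0 := fun v => by
    split_ifs with hv
    · simpa [add_comm] using card_filter_le (univ : Finset (Fin (m + 1))) _
    -- A vertex not adjacent to `x i` can only be a common neighbour of the others.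
    obtain ⟨i, hi⟩ : ∃ i, ¬ G.Adj (x i) v := by simpa [mem_commonNbhd] using hv
    refine (card_le_one.2 ?_).trans (Nat.le_add_right _ _)
    suffices ∀ p, v ∈ commonNbhd G.Adj (Set.range (p.removeNth x)) → p = i by
      intro p hp q hq
      rw [this p (mem_filter.1 hp).2, this q (mem_filter.1 hq).2]
    intro p hp
    by_contra hpi
    obtain ⟨j, rfl⟩ := Fin.exists_succAbove_eq (Ne.symm hpi)
    exact hi (mem_commonNbhd.1 hp _ ⟨j, rfl⟩)
  calc ∑ p : Fin (m + 1), #(commonNbhd G.Adj (Set.range (p.removeNth x)))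
      = ∑ v, #{p : Fin (m + 1) | v ∈ commonNbhd G.Adj (Set.range (p.removeNth x))} := by
        simpa [bipartiteAbove, bipartiteBelow] using
          sum_card_bipartiteAbove_eq_sum_card_bipartiteBelow (s := univ) (t := univ)
            fun (p : Fin (m + 1)) v => v ∈ commonNbhd G.Adj (Set.range (p.removeNth x))
    _ ≤ ∑ v, (1 + m * if v ∈ commonNbhd G.Adj (Set.range x) then 1 else 0) :=
        sum_le_sum fun v _ => hcount v
    _ = Fintype.card V + m * #(commonNbhd G.Adj (Set.range x)) := by
        simp [sum_add_distrib, mul_comm]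

theorem moon_moser (G : SimpleGraph V) (m : ℕ) :
    (m + 1) * #(orderedCliques G (m + 1)) ^ 2 ≤ #(orderedCliques G m) *
      (Fintype.card V * #(orderedCliques G (m + 1)) + m * #(orderedCliques G (m + 2))) := by
  have hsq : #(orderedCliques G (m + 1)) ^ 2 ≤ #(orderedCliques G m) *
      ∑ y ∈ orderedCliques G m, #(commonNbhd G.Adj (Set.range y)) ^ 2 := by
    rw [card_orderedCliques_succ]
    exact sq_sum_le_card_mul_sum_sq
  have hsum : (m + 1) * ∑ y ∈ orderedCliques G m, #(commonNbhd G.Adj (Set.range y)) ^ 2 ≤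
      Fintype.card V * #(orderedCliques G (m + 1)) + m * #(orderedCliques G (m + 2)) := calc
    _ = ∑ p : Fin (m + 1), ∑ x ∈ orderedCliques G (m + 1),
          #(commonNbhd G.Adj (Set.range (p.removeNth x))) := by
      simp [sum_orderedCliques_removeNth _ fun y => #(commonNbhd G.Adj (Set.range y)), sq]
    _ ≤ ∑ x ∈ orderedCliques G (m + 1),
          (Fintype.card V + m * #(commonNbhd G.Adj (Set.range x))) := by
      rw [sum_comm]
      exact sum_le_sum fun x _ => sum_card_commonNbhd_removeNth_le x
    _ = _ := by
      rw [card_orderedCliques_succ G (m + 1), sum_add_distrib, mul_sum, sum_const, smul_eq_mul,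
        mul_comm]
  calc (m + 1) * #(orderedCliques G (m + 1)) ^ 2
      ≤ (m + 1) * (#(orderedCliques G m) *
          ∑ y ∈ orderedCliques G m, #(commonNbhd G.Adj (Set.range y)) ^ 2) := by gcongr
    _ = #(orderedCliques G m) * ((m + 1) *
          ∑ y ∈ orderedCliques G m, #(commonNbhd G.Adj (Set.range y)) ^ 2) := by ring
    _ ≤ _ := by gcongr

theorem card_orderedCliques_one (G : SimpleGraph V) :
    #(orderedCliques G 1) = Fintype.card V := by
  have : orderedCliques G 1 = univ := by
    ext x
    simp [mem_orderedCliques, Subsingleton.pairwise]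
  simp [this]

theorem card_orderedCliques_two (G : SimpleGraph V) :
    #(orderedCliques G 2) = 2 * G.edgeSet.ncard := by
  classical
  rw [two_mul_ncard_edgeSet]
  refine card_equiv (finTwoArrowEquiv V) fun x => ?_
  simp [mem_orderedCliques, Pairwise, Fin.forall_fin_two, G.adj_comm (x 1)]

/-- In terms of the clique ratios `k_{m+1} / k_m` the Moon–Moser inequality is a recursion. -/
theorem mul_card_orderedCliques_succ_le {c : ℝ}
    (hc : c * Fintype.card V * #(orderedCliques G m) ≤ #(orderedCliques G (m + 1))) :
    ((m + 1) * c - 1) * Fintype.card V * #(orderedCliques G (m + 1)) ≤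
      m * #(orderedCliques G (m + 2)) := by
  have hmm : ((m : ℝ) + 1) * #(orderedCliques G (m + 1)) ^ 2 ≤ #(orderedCliques G m) *
      (Fintype.card V * #(orderedCliques G (m + 1)) + m * #(orderedCliques G (m + 2))) := by
    exact_mod_cast moon_moser G m
  obtain hzero | hpos := (#(orderedCliques G m)).eq_zero_or_pos
  · have hzero' : #(orderedCliques G (m + 1)) = 0 := by
      have h := moon_moser G m
      rw [hzero, zero_mul, Nat.le_zero] at h
      simpa using h
    rw [hzero', Nat.cast_zero, mul_zero]
    positivity
  · have hpos' : (0 : ℝ) < #(orderedCliques G m) := by exact_mod_cast hpos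
    suffices ((m : ℝ) + 1) * c * Fintype.card V * #(orderedCliques G (m + 1)) ≤
        Fintype.card V * #(orderedCliques G (m + 1)) + m * #(orderedCliques G (m + 2)) by
      linarith
    refine le_of_mul_le_mul_left (le_trans ?_ hmm) hpos'
    have hm0 : (0 : ℝ) ≤ (m + 1) * #(orderedCliques G (m + 1)) := by positivity
    linarith [mul_le_mul_of_nonneg_left hc hm0]

theorem one_sub_mul_card_orderedCliques_le {θ : ℝ}
    (hG : (1 - θ) * (Fintype.card V : ℝ) ^ 2 ≤ 2 * G.edgeSet.ncard) (hm : 1 ≤ m) :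
    (1 - m * θ) * Fintype.card V * #(orderedCliques G m) ≤ #(orderedCliques G (m + 1)) := by
  induction m, hm using Nat.le_induction with
  | base =>
    rw [card_orderedCliques_one, card_orderedCliques_two]
    push_cast
    linarith
  | succ m hm ih =>
    have hm0 : (0 : ℝ) < m := by exact_mod_cast hm
    refine le_of_mul_le_mul_left ?_ hm0
    push_cast
    linarith [mul_card_orderedCliques_succ_le ih]

theorem pow_mul_le_card_orderedCliques {r : ℕ} (hr : 1 ≤ r) {δ : ℝ} (hδ : 0 ≤ δ)
    (hG : (1 - 1 / (r : ℝ) + δ) * (Fintype.card V : ℝ) ^ 2 ≤ 2 * G.edgeSet.ncard) :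
    δ ^ r * (Fintype.card V : ℝ) ^ (r + 1) ≤ #(orderedCliques G (r + 1)) := by
  suffices ∀ m ≤ r, δ ^ m * (Fintype.card V : ℝ) ^ (m + 1) ≤ #(orderedCliques G (m + 1)) from
    this r le_rfl
  intro m hm
  induction m with
  | zero => simp [card_orderedCliques_one]
  | succ m ih =>
    have hr0 : (0 : ℝ) < r := by exact_mod_cast hr
    have hm' : ((m + 1 : ℕ) : ℝ) / r ≤ 1 := (div_le_one hr0).2 (by exact_mod_cast hm)
    have hcoef : δ ≤ 1 - (m + 1 : ℕ) * (1 / (r : ℝ) - δ) := by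
      have hmδ : 0 ≤ (m : ℝ) * δ := by positivity
      rw [mul_sub, mul_one_div]
      push_cast at hm' ⊢
      linarith
    calc δ ^ (m + 1) * (Fintype.card V : ℝ) ^ (m + 1 + 1)
        = δ * Fintype.card V * (δ ^ m * (Fintype.card V : ℝ) ^ (m + 1)) := by ring
      _ ≤ δ * Fintype.card V * #(orderedCliques G (m + 1)) := by
          gcongr
          exact ih (by omega)
      _ ≤ (1 - (m + 1 : ℕ) * (1 / (r : ℝ) - δ)) * Fintype.card V * #(orderedCliques G (m + 1)) := by
          gcongr
      _ ≤ #(orderedCliques G (m + 1 + 1)) :=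
          one_sub_mul_card_orderedCliques_le (by convert hG using 2; ring) (by omega)

end Supersaturation

section DependentRandomChoice

theorem card_mul_pow_le_sum_pow {ι : Type*} {s : Finset ι} {f : ι → ℝ} (hf : ∀ i ∈ s, 0 ≤ f i)
    {c : ℝ} (hc : 0 ≤ c) (h : #s * c ≤ ∑ i ∈ s, f i) (l : ℕ) : #s * c ^ l ≤ ∑ i ∈ s, f i ^ l := by
  obtain _ | l := l
  · simp
  obtain rfl | hs := s.eq_empty_or_nonempty
  · simp
  have : (0 : ℝ) < #s := by exact_mod_cast hs.card_pos
  calc (#s : ℝ) * c ^ (l + 1) = (#s * c) ^ (l + 1) / #s ^ l := by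
        rw [eq_div_iff (by positivity)]
        ring
    _ ≤ (∑ i ∈ s, f i) ^ (l + 1) / #s ^ l := by gcongr
    _ ≤ ∑ i ∈ s, f i ^ (l + 1) := pow_sum_div_card_le_sum_pow hf l

theorem sum_card_filter_forall_mem {ι W : Type*} [Fintype W] [DecidableEq W] (s : Finset ι)
    (N : ι → Finset W) (l : ℕ) :
    ∑ w : Fin l → W, #{i ∈ s | ∀ j, w j ∈ N i} = ∑ i ∈ s, #(N i) ^ l := by
  have hpi : ∀ i, #{w : Fin l → W | ∀ j, w j ∈ N i} = #(N i) ^ l := fun i => by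
    rw [← Fintype.card_piFinset_const]
    congr 1
    ext w
    simp
  simpa only [bipartiteAbove, bipartiteBelow, hpi] using
    (sum_card_bipartiteAbove_eq_sum_card_bipartiteBelow (s := s) (t := univ)
      fun i (w : Fin l → W) => ∀ j, w j ∈ N i).symm

variable {V W : Type*} [Fintype V] [Fintype W] {R : V → W → Prop}

theorem mul_pow_le_sum_card_commonNbhd [DecidableRel R] {γ : ℝ} (hγ : 0 ≤ γ)
    (hR : γ * Fintype.card V * Fintype.card W ≤ #{p : V × W | R p.1 p.2}) (l : ℕ) :
    γ ^ l * Fintype.card V * (Fintype.card W : ℝ) ^ l ≤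
      ∑ w : Fin l → W, (#(commonNbhd (flip R) (Set.range w)) : ℝ) := by
  classical
  have hdeg : (#{p : V × W | R p.1 p.2} : ℝ) = ∑ v, (#{w | R v w} : ℝ) := by
    simp only [card_filter, Fintype.sum_prod_type, Nat.cast_sum]
  have hcount : ∑ w : Fin l → W, #(commonNbhd (flip R) (Set.range w)) =
      ∑ v, #{w | R v w} ^ l := by
    rw [← sum_card_filter_forall_mem]
    simp [commonNbhd, flip]
  calc γ ^ l * Fintype.card V * (Fintype.card W : ℝ) ^ l
      = #(univ : Finset V) * (γ * Fintype.card W) ^ l := by rw [card_univ]; ring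
    _ ≤ ∑ v, (#{w | R v w} : ℝ) ^ l := by
        refine card_mul_pow_le_sum_pow (by simp) (by positivity) ?_ l
        rw [← hdeg, card_univ]
        linarith
    _ = _ := by exact_mod_cast hcount.symm

open Classical in
theorem sum_card_filter_subset_commonNbhd_le {𝓑 : Finset (Finset V)} {t : ℕ}
    (h𝓑 : (𝓑 : Set (Finset V)).Sized t) {c : ℝ} (hc₀ : 0 ≤ c)
    (hc : ∀ S ∈ 𝓑, (#(commonNbhd R (S : Set V)) : ℝ) ≤ c) (l : ℕ) :
    ∑ w : Fin l → W, (#{S ∈ 𝓑 | S ⊆ commonNbhd (flip R) (Set.range w)} : ℝ) ≤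
      (Fintype.card V : ℝ) ^ t * c ^ l := by
  have hcount : ∑ w : Fin l → W, #{S ∈ 𝓑 | S ⊆ commonNbhd (flip R) (Set.range w)} =
      ∑ S ∈ 𝓑, #(commonNbhd R (S : Set V)) ^ l := by
    rw [← sum_card_filter_forall_mem]
    refine sum_congr rfl fun w _ => congrArg card (filter_congr fun S _ => ?_)
    simp only [subset_iff, mem_commonNbhd, Set.forall_mem_range, mem_coe, flip]
    tauto
  have hcard : #𝓑 ≤ Fintype.card V ^ t := calc
    #𝓑 ≤ (Fintype.card V).choose t := h𝓑.card_le
    _ ≤ Fintype.card V ^ t := Nat.choose_le_pow _ _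
  calc _ = ∑ S ∈ 𝓑, (#(commonNbhd R (S : Set V)) : ℝ) ^ l := by exact_mod_cast hcount
    _ ≤ #𝓑 * c ^ l := by
        rw [← nsmul_eq_mul]
        refine sum_le_card_nsmul _ _ _ fun S hS => ?_
        gcongr
        exact hc S hS
    _ ≤ (Fintype.card V : ℝ) ^ t * c ^ l := by
        gcongr
        exact_mod_cast hcard

theorem dependent_random_choice [DecidableRel R] [Nonempty V] [Nonempty W] {γ μ : ℝ} {t l : ℕ}
    (hγ : 0 < γ) (hμ : 0 ≤ μ) (hR : γ * Fintype.card V * Fintype.card W ≤ #{p : V × W | R p.1 p.2})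
    (hl : (Fintype.card V : ℝ) ^ t * μ ^ l ≤ γ ^ l / 2) :
    ∃ U : Finset V, γ ^ l / 2 * Fintype.card V ≤ #U ∧
      ∀ S ⊆ U, #S = t → μ * Fintype.card W ≤ #(commonNbhd R (S : Set V)) := by
  classical
  set n : ℝ := (Fintype.card V : ℝ)
  set N : ℝ := (Fintype.card W : ℝ)
  have hn : 0 < n := Nat.cast_pos.2 Fintype.card_pos
  let U : (Fin l → W) → Finset V := fun w => commonNbhd (flip R) (Set.range w)
  let 𝓑 : Finset (Finset V) :=
    {S ∈ univ.powersetCard t | (#(commonNbhd R (S : Set V)) : ℝ) < μ * N}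
  let b : (Fin l → W) → ℕ := fun w => #{S ∈ 𝓑 | S ⊆ U w}
  have hU : γ ^ l * n * N ^ l ≤ ∑ w, (#(U w) : ℝ) :=
    mul_pow_le_sum_card_commonNbhd hγ.le hR l
  have hb : ∑ w, (b w : ℝ) ≤ n ^ t * (μ * N) ^ l :=
    sum_card_filter_subset_commonNbhd_le (fun S hS => (mem_powersetCard.1 (mem_filter.1 hS).1).2)
      (by positivity) (fun S hS => (mem_filter.1 hS).2.le) l
  obtain ⟨w, -, hw⟩ : ∃ w ∈ univ, γ ^ l / 2 * n ≤ #(U w) - n * b w := by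
    refine exists_le_of_sum_le univ_nonempty ?_
    calc ∑ _w : Fin l → W, γ ^ l / 2 * n = γ ^ l * n * N ^ l - n * (γ ^ l / 2 * N ^ l) := by
          simp [N]
          ring
      _ ≤ ∑ w, (#(U w) : ℝ) - n * (n ^ t * μ ^ l * N ^ l) := by gcongr
      _ ≤ ∑ w, (#(U w) : ℝ) - n * ∑ w, (b w : ℝ) := by
          rw [mul_assoc (n ^ t), ← mul_pow]
          gcongr
      _ = ∑ w, ((#(U w) : ℝ) - n * b w) := by rw [sum_sub_distrib, mul_sum]
  have hgood : b w = 0 := by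
    have hUn : (#(U w) : ℝ) ≤ n := Nat.cast_le.2 (card_le_univ _)
    have hpos : 0 < γ ^ l / 2 * n := by positivity
    have hb1 : n * b w < n * 1 := by linarith
    simpa using lt_of_mul_lt_mul_left hb1 hn.le
  refine ⟨U w, by simpa [hgood] using hw, fun S hS hcard => ?_⟩
  by_contra! hlt
  have hbad : S ∈ 𝓑 := mem_filter.2 ⟨mem_powersetCard_univ.2 hcard, hlt⟩
  exact notMem_empty S (card_eq_zero.1 hgood ▸ mem_filter.2 ⟨hbad, hS⟩)

/-- Dependent random choice is applied to the first coordinate of `R`; the common neighbourhood of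
the member of `𝒜` found there is a dense relation in the remaining coordinates. -/
theorem exists_piFinset_subset {V : Type*} [Fintype V] [Nonempty V] {𝒜 : Set (Finset V)}
    {t q : ℕ} (h𝒜 : 𝒜.Sized t) {c : ℝ}
    (hc : ∀ U : Finset V, c * Fintype.card V ≤ #U → ∃ S ⊆ U, S ∈ 𝒜) {a : ℕ → ℝ}
    (ha : ∀ k, 0 < a k)
    (hstep : ∀ k < q, ∃ l : ℕ,
      (Fintype.card V : ℝ) ^ t * a (k + 1) ^ l ≤ a k ^ l / 2 ∧ c ≤ a k ^ l / 2)
    {R : Finset (Fin q → V)} (hR : a 0 * (Fintype.card V : ℝ) ^ q ≤ #R) :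
    ∃ S : Fin q → Finset V, (∀ i, S i ∈ 𝒜) ∧ Fintype.piFinset S ⊆ R := by
  classical
  induction q generalizing a with
  | zero =>
    have hpos : (0 : ℝ) < #R := (ha 0).trans_le (by simpa using hR)
    obtain ⟨y, hy⟩ := card_pos.1 (Nat.cast_pos.1 hpos)
    exact ⟨fun i => i.elim0, fun i => i.elim0, fun x _ => Subsingleton.elim y x ▸ hy⟩
  | succ q ih =>
    let T : V → (Fin q → V) → Prop := fun v w => (Fin.cons v w : Fin (q + 1) → V) ∈ R
    have hT : #{p : V × (Fin q → V) | T p.1 p.2} = #R :=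
      card_equiv (Fin.consEquiv fun _ => V) fun p => by simp [T, Fin.consEquiv]
    obtain ⟨l, hl, hcl⟩ := hstep 0 q.succ_pos
    obtain ⟨U, hU, hUT⟩ := dependent_random_choice (R := T) (ha 0) (ha 1).le
      (by rwa [hT, Fintype.card_fun, Fintype.card_fin, Nat.cast_pow, mul_assoc, ← pow_succ']) hl
    obtain ⟨S₀, hS₀U, hS₀⟩ := hc U (hU.trans' (by gcongr))
    have hR' : a 1 * (Fintype.card V : ℝ) ^ q ≤ #(commonNbhd T (S₀ : Set V)) := by
      simpa using hUT S₀ hS₀U (h𝒜 hS₀)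
    obtain ⟨S, hS, hSR⟩ := ih (a := fun k => a (k + 1)) (fun k => ha (k + 1))
      (fun k hk => hstep (k + 1) (Nat.succ_lt_succ hk)) hR'
    refine ⟨Fin.cons S₀ S, Fin.cases hS₀ hS, fun x hx => ?_⟩
    rw [Fintype.mem_piFinset] at hx
    have htail : Fin.tail x ∈ commonNbhd T (S₀ : Set V) :=
      hSR (Fintype.mem_piFinset.2 fun i => hx i.succ)
    simpa [T] using mem_commonNbhd.1 htail (x 0) (hx 0)

theorem not_cliqueFree_of_piFinset_subset {V : Type*} [Fintype V] {G : SimpleGraph V} {q t : ℕ}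
    (ht : 1 ≤ t) {S : Fin q → Finset V} (hS : ∀ i, G.IsNClique t (S i))
    (hSG : Fintype.piFinset S ⊆ orderedCliques G q) : ¬ G.CliqueFree (q * t) := by
  classical
  have hadj : ∀ i j, i ≠ j → ∀ a ∈ S i, ∀ b ∈ S j, G.Adj a b := by
    intro i j hij a ha b hb
    have hne : ∀ k, (S k).Nonempty := fun k => card_pos.1 (by rw [(hS k).card_eq]; exact ht)
    choose x hx using hne
    have hmem : Function.update (Function.update x i a) j b ∈ Fintype.piFinset S := by
      rw [Fintype.mem_piFinset]
      intro k
      simp only [Function.update_apply]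
      split_ifs with hkj hki
      · exact hkj ▸ hb
      · exact hki ▸ ha
      · exact hx k
    simpa [Function.update_apply, hij] using mem_orderedCliques.1 (hSG hmem) hij
  have hclique : G.IsClique (univ.biUnion S : Finset V) := by
    intro a ha b hb hab
    obtain ⟨i, -, hi⟩ := mem_biUnion.1 (mem_coe.1 ha)
    obtain ⟨j, -, hj⟩ := mem_biUnion.1 (mem_coe.1 hb)
    obtain rfl | hij := eq_or_ne i j
    · exact (hS i).isClique hi hj hab
    · exact hadj i j hij a hi b hj
  have hcard : #(univ.biUnion S) = q * t := by
    have hdisj : ∀ i ∈ univ, ∀ j ∈ univ, i ≠ j → Disjoint (S i) (S j) := fun i _ j _ hij =>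
      disjoint_left.2 fun a hi hj => (hadj i j hij a hi a hj).ne rfl
    simp [card_biUnion hdisj, fun i => (hS i).card_eq]
  exact fun h => h _ ⟨hclique, hcard⟩

end DependentRandomChoice

section WeakScale

variable {ε : ℝ}

theorem tendsto_logb_natCast : Tendsto (fun n : ℕ => Real.logb 2 n) atTop atTop :=
  (Real.tendsto_logb_atTop one_lt_two).comp tendsto_natCast_atTop_atTop

theorem weakScale_pos (ε : ℝ) (n : ℕ) : 0 < weakScale ε n := Real.rpow_pos_of_pos two_pos _

theorem weakScale_le_one (ε : ℝ) (n : ℕ) : weakScale ε n ≤ 1 := by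
  refine Real.rpow_le_one_of_one_le_of_nonpos one_le_two (neg_nonpos.2 (Real.rpow_nonneg ?_ _))
  obtain rfl | hn := n.eq_zero_or_pos
  · simp
  · exact Real.logb_nonneg one_lt_two (by exact_mod_cast hn)

theorem tendsto_weakScale (hε : ε < 1) : Tendsto (weakScale ε) atTop (𝓝 0) := by
  have h := (tendsto_rpow_atTop (sub_pos.2 hε)).comp tendsto_logb_natCast
  exact (tendsto_rpow_atBot_of_base_gt_one 2 one_lt_two).comp (tendsto_neg_atTop_atBot.comp h)

theorem weakScale_le_weakScale {ε' : ℝ} (h : ε' ≤ ε) {n : ℕ} (hn : 1 ≤ Real.logb 2 n) :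
    weakScale ε' n ≤ weakScale ε n :=
  Real.rpow_le_rpow_of_exponent_le one_le_two <|
    neg_le_neg (Real.rpow_le_rpow_of_exponent_le hn (by linarith))

theorem exists_nat_exponent (t : ℕ) {u y : ℝ} (hu : 1 ≤ u) (hy : t + 3 ≤ y) :
    ∃ l : ℕ, t * (u * y ^ 4) + u * l + 1 ≤ u * y ^ 3 * l ∧ u * l + 2 ≤ u * y ^ 3 := by
  have : (0 : ℝ) ≤ t := t.cast_nonneg
  have hy0 : 0 ≤ y := by linarith
  have hlb : y ^ 2 ≤ ⌈y ^ 2⌉₊ := Nat.le_ceil _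
  have hub : (⌈y ^ 2⌉₊ : ℝ) ≤ y ^ 2 + 1 := (Nat.ceil_lt_add_one (by positivity)).le
  have hy3 : y ^ 2 + 3 ≤ y ^ 3 := by nlinarith [sq_nonneg y]
  have hul : u * ⌈y ^ 2⌉₊ + 2 ≤ u * y ^ 3 := calc
    u * ⌈y ^ 2⌉₊ + 2 ≤ u * (y ^ 2 + 1) + u * 2 := by gcongr; linarith
    _ = u * (y ^ 2 + 3) := by ring
    _ ≤ u * y ^ 3 := by gcongr
  refine ⟨⌈y ^ 2⌉₊, ?_, hul⟩
  calc t * (u * y ^ 4) + u * ⌈y ^ 2⌉₊ + 1 ≤ t * (u * y ^ 4) + u * y ^ 3 := by linarith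
    _ ≤ t * (u * y ^ 4) + u * y ^ 4 := by gcongr <;> linarith
    _ = (t + 1) * (u * y ^ 4) := by ring
    _ ≤ y * (u * y ^ 4) := by gcongr; linarith
    _ = u * y ^ 3 * y ^ 2 := by ring
    _ ≤ u * y ^ 3 * ⌈y ^ 2⌉₊ := by gcongr

theorem eventually_exists_weakScale_pow_le (t : ℕ) (hε : 0 < ε) (hε1 : ε ≤ 1) :
    ∀ᶠ n : ℕ in atTop, ∃ l : ℕ,
      (n : ℝ) ^ t * weakScale (ε / 4) n ^ l ≤ weakScale ε n ^ l / 2 ∧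
        2 * weakScale (ε / 4) n ≤ weakScale ε n ^ l / 2 := by
  have hε4 : 0 < ε / 4 := by positivity
  filter_upwards [tendsto_logb_natCast.eventually_ge_atTop 1, eventually_gt_atTop 0,
    ((tendsto_rpow_atTop hε4).comp tendsto_logb_natCast).eventually_ge_atTop (t + 3)]
    with n hL hn hy
  set L := Real.logb 2 (n : ℝ) with hLdef
  set y := L ^ (ε / 4)
  set u := L ^ (1 - ε) with hudef
  have hL0 : 0 < L := by linarith
  have hu : 1 ≤ u := Real.one_le_rpow hL (by linarith)
  have hypow : ∀ k : ℕ, y ^ k = L ^ (ε / 4 * k) := fun k => by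
    rw [Real.rpow_mul hL0.le, Real.rpow_natCast]
  have hLu : L = u * y ^ 4 := by
    rw [hudef, hypow, ← Real.rpow_add hL0,
      show 1 - ε + ε / 4 * (4 : ℕ) = 1 by push_cast; ring, Real.rpow_one]
  have hscale' : weakScale (ε / 4) n = 2 ^ (-(u * y ^ 3)) := by
    rw [hudef, hypow, ← Real.rpow_add hL0, weakScale]
    congr 3
    push_cast
    ring
  have hscale : weakScale ε n = 2 ^ (-u) := rfl
  have hn2 : (n : ℝ) = 2 ^ (u * y ^ 4) := by
    rw [← hLu, hLdef, Real.rpow_logb two_pos (by norm_num) (by exact_mod_cast hn)]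
  obtain ⟨l, hl, hl'⟩ := exists_nat_exponent (y := y) t hu hy
  have hhalf : weakScale ε n ^ l / 2 = 2 ^ (-(u * l) - 1) := by
    rw [hscale, ← Real.rpow_mul_natCast two_pos.le, Real.rpow_sub two_pos, Real.rpow_one, neg_mul]
  refine ⟨l, ?_, ?_⟩
  · rw [hhalf, hscale', hn2, ← Real.rpow_mul_natCast two_pos.le,
      ← Real.rpow_mul_natCast two_pos.le, ← Real.rpow_add two_pos]
    exact Real.rpow_le_rpow_of_exponent_le one_le_two (by linarith)
  · rw [hhalf, hscale', mul_comm, ← Real.rpow_add_one two_pos.ne']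
    exact Real.rpow_le_rpow_of_exponent_le one_le_two (by linarith)

theorem eventually_exists_piFinset_subset (q t : ℕ) (hε : 0 < ε) (hε1 : ε ≤ 1) :
    ∀ᶠ n : ℕ in atTop, ∀ 𝒜 : Set (Finset (Fin n)), 𝒜.Sized t →
      (∀ U : Finset (Fin n), 2 * weakScale (ε / 4 ^ q) n * n ≤ #U → ∃ S ⊆ U, S ∈ 𝒜) →
      ∀ R : Finset (Fin q → Fin n), weakScale ε n * (n : ℝ) ^ q ≤ #R →
        ∃ S : Fin q → Finset (Fin n), (∀ i, S i ∈ 𝒜) ∧ Fintype.piFinset S ⊆ R := by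
  have hdecr : ∀ k l : ℕ, k ≤ l → ε / 4 ^ l ≤ ε / 4 ^ k := fun k l hkl => by
    gcongr
    norm_num
  have hparam : ∀ᶠ n : ℕ in atTop, ∀ k ∈ range q, ∃ l : ℕ,
      (n : ℝ) ^ t * weakScale (ε / 4 ^ k / 4) n ^ l ≤ weakScale (ε / 4 ^ k) n ^ l / 2 ∧
        2 * weakScale (ε / 4 ^ k / 4) n ≤ weakScale (ε / 4 ^ k) n ^ l / 2 :=
    (eventually_all_finset _).2 fun k _ => eventually_exists_weakScale_pow_le t (by positivity)
      (((hdecr 0 k k.zero_le).trans_eq (by simp)).trans hε1)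
  filter_upwards [hparam, tendsto_logb_natCast.eventually_ge_atTop 1, eventually_gt_atTop 0]
    with n hn hL hn0 𝒜 h𝒜 hlarge R hR
  have : NeZero n := ⟨hn0.ne'⟩
  refine exists_piFinset_subset h𝒜 (by simpa using hlarge)
    (a := fun k => weakScale (ε / 4 ^ k) n) (fun k => weakScale_pos _ n) (fun k hk => ?_)
    (by simpa using hR)
  obtain ⟨l, hl, hl'⟩ := hn k (mem_range.2 hk)
  rw [div_div, ← pow_succ] at hl hl'
  refine ⟨l, by simpa using hl, le_trans ?_ hl'⟩
  gcongr
  exact weakScale_le_weakScale (hdecr (k + 1) q hk) hL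

end WeakScale

section UpperBound

variable {s t r : ℕ} {ε : ℝ}

theorem exists_isNClique_subset_of_weakScale {n : ℕ} (ht : 2 ≤ t) (hn : 0 < n)
    {G : SimpleGraph (Fin n)} (hα : (G.indepNum : ℝ) < weakScale ε n * ramseyInv t n)
    {U : Finset (Fin n)} (hU : 2 * weakScale ε n * n ≤ #U) : ∃ S ⊆ U, G.IsNClique t S := by
  refine exists_isNClique_subset ht ?_
  rw [Fintype.card_fin, ← Nat.cast_lt (α := ℝ)]
  push_cast
  calc 2 * (n : ℝ) * G.indepNum < 2 * n * (weakScale ε n * ramseyInv t n) := by gcongr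
    _ = ramseyInv t n * (2 * weakScale ε n * n) := by ring
    _ ≤ ramseyInv t n * #U := by gcongr

theorem upperDensity_weakScale_mul_ramseyInv_le (ht : 2 ≤ t) (hr : 1 ≤ r)
    (hs : s ≤ (r + 1) * t) (hε : 0 < ε) (hε1 : ε < 1) :
    upperDensity (completeGraph (Fin s))
      (fun n => weakScale (ε / 4 ^ (r + 1)) n * (ramseyInv t n : ℝ)) ≤ (1 - 1 / (r : ℝ)) / 2 := by
  refine le_of_forall_pos_le_add fun δ hδ => upperDensity_le_of_eventually ?_
  filter_upwards [eventually_exists_piFinset_subset (r + 1) t hε hε1.le,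
    (tendsto_weakScale hε1).eventually_le_const (by positivity : 0 < (2 * δ) ^ r),
    eventually_gt_atTop 0] with n hproduct hδn hn
  have hr1 : 1 / (r : ℝ) ≤ 1 := by
    simpa using Nat.cast_inv_le_one (α := ℝ) r
  rw [div_le_iff₀ (by positivity)]
  refine rtNumber_le (mul_nonneg (by linarith) (by positivity)) fun G hfree hα => ?_
  by_contra! hedges
  have hcliques : (2 * δ) ^ r * (n : ℝ) ^ (r + 1) ≤ #(orderedCliques G (r + 1)) := by
    simpa using pow_mul_le_card_orderedCliques (G := G) hr (δ := 2 * δ) (by positivity)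
      (by rw [Fintype.card_fin]; linarith)
  obtain ⟨S, hS, hSG⟩ := hproduct {S | G.IsNClique t S} (fun S hS => hS.card_eq)
    (fun U hU => exists_isNClique_subset_of_weakScale ht hn hα hU)
    (orderedCliques G (r + 1)) (hcliques.trans' (by gcongr))
  exact not_cliqueFree_of_piFinset_subset (by omega) hS hSG
    ((free_completeGraph_iff_cliqueFree.1 hfree).mono hs)

theorem exists_upperDensity_weakScale_mul_ramseyInv_le (s : ℕ) (ht : 2 ≤ t) :
    ∃ ε : ℝ, 0 < ε ∧ ε < 1 ∧
      upperDensity (completeGraph (Fin s)) (fun n => weakScale ε n * (ramseyInv t n : ℝ)) ≤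
        upperDensity (completeGraph (Fin s)) (fun n => (ramseyInv (t + 1) n : ℝ)) := by
  obtain hst | hst := le_or_gt s t
  · refine ⟨1 / 2, by norm_num, by norm_num, le_trans ?_ upperDensity_nonneg⟩
    refine upperDensity_le_of_eventually (.of_forall fun n => ?_)
    rw [rtNumber_completeGraph_eq_zero hst
      (mul_le_of_le_one_left (Nat.cast_nonneg _) (weakScale_le_one _ n))]
    simp
  have hr : 1 ≤ (s - 1) / t := (Nat.one_le_div_iff (by omega)).2 (by omega)
  have hlower : (s - 1) / t * t < s := by
    have := Nat.div_mul_le_self (s - 1) t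
    omega
  have hupper : s ≤ ((s - 1) / t + 1) * t := by
    have := Nat.lt_div_mul_add (a := s - 1) (b := t) (by omega)
    rw [add_one_mul]
    omega
  refine ⟨1 / 2 / 4 ^ ((s - 1) / t + 1), by positivity, ?_,
    (upperDensity_weakScale_mul_ramseyInv_le ht hr hupper one_half_pos one_half_lt_one).trans
      (le_upperDensity_ramseyInv_succ (by omega) hr hlower)⟩
  exact (div_le_self one_half_pos.le (one_le_pow₀ (by norm_num))).trans_lt one_half_lt_one

end UpperBound

end RamseyTuran

theorem mainTheorem7 (s t : ℕ) (ht : 2 ≤ t)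
    (h : RamseyTuran.HasPhaseTransition (SimpleGraph.completeGraph (Fin s))
      (fun n => (RamseyTuran.ramseyInv t n : ℝ))
      (fun n => (RamseyTuran.ramseyInv (t + 1) n : ℝ))) :
    RamseyTuran.HasWeakPhaseTransition (SimpleGraph.completeGraph (Fin s))
      (fun n => (RamseyTuran.ramseyInv t n : ℝ)) := by
  obtain ⟨ε, hε0, hε1, hdensity⟩ :=
    RamseyTuran.exists_upperDensity_weakScale_mul_ramseyInv_le s ht
  exact ⟨ε, hε0, RamseyTuran.tendsto_weakScale hε1,
    fun n => mul_le_of_le_one_left (Nat.cast_nonneg _) (RamseyTuran.weakScale_le_one ε n),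
    hdensity.trans_lt h.2⟩
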